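/- Let $\mathcal X$ be the set of mm-isomorphism classes of mm-spaces. Here an mm-space is a complete separable metric space $X$ with a Borel probability measure $\mu_X$; $X$ and $Y$ are mm-isomorphic if there is a bijective isometry $\operatorname{supp}\mu_X\to\operatorname{supp}\mu_Y$ pushing $\mu_X$ forward to $\mu_Y$, and we assume $X=\operatorname{supp}\mu_X$ throughout. Write $Y\prec X$ (the Lipschitz order) if there is a $1$-Lipschitz map $f:X\to Y$ with $f_*\mu_X=\mu_Y$. The box distance $\square(X,Y)$ is the infimum of $\max\{\operatorname{dis}(S),\,1-\pi(S)\}$ over all couplings $\pi$ of $\mu_X$ and $\mu_Y$ and all Borel sets $S\subset X\times Y$, where $\operatorname{dis}(S)=\sup\{|d_X(x,x')-d_Y(y,y')| : (x,y),(x',y')\in S\}$ and $\operatorname{dis}(\emptyset)=0$; the box topology is the topology on $\mathcal X$ induced by $\square$. A pyramid is a nonempty subset $\mathcal P\subset\mathcal X$ such that 1. $\mathcal P$ is closed in the box topology; 2. if $Y\in\mathcal P$ and $X\prec Y$, then $X\in\mathcal P$; 3. for all $X,Y\in\mathcal P$ there is $Z\in\mathcal P$ with $X\prec Z$ and $Y\prec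 Z$. **Theorem.** Let $N\in\{1,2,\dots\}\cup\{\infty\}$, let $[N]=\{1,\dots,N\}$ if $N<\infty$ and $[N]=\{1,2,\dots\}$ if $N=\infty$, and let $(a_n)_{n\in[N]}$ be numbers in $(0,1]$ with $\sum_{n\in[N]}a_n=1$. Let $\mathcal P_n$, $n\in[N]$, be pyramids. Then the direct sum $$\sum_{n=1}^N\mathcal P_n^{a_n}:=\Bigl\{X\in\mathcal X \;\Big|\; \text{for } n\in[N] \text{ there are } X_n\in\mathcal P_n \text{ and } 1\text{-Lipschitz maps } f_n:X_n\to X \text{ such that } \mu_X=\sum_{n=1}^N a_n(f_n)_*\mu_{X_n}\Bigr\}$$ is a pyramid. -/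

import Mathlib

open MeasureTheory Set Topology
open scoped ENNReal

universe u v w

/-- A metric measure space: a complete separable metric space with a Borel probability measure. -/
structure MMSpace : Type (u + 1) where
  carrier : Type u
  [metric : MetricSpace carrier]
  [complete : CompleteSpace carrier]
  [separable : TopologicalSpace.SeparableSpace carrier]
  [meas : MeasurableSpace carrier]
  [borel : BorelSpace carrier]
  μ : Measure carrier
  [prob : IsProbabilityMeasure μ]

namespace MMSpace

instance : CoeSort MMSpace.{u} (Type u) := ⟨carrier⟩

attribute [instance] metric complete separable meas borel prob

instance (X : MMSpace.{u}) : SecondCountableTopology X :=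
  UniformSpace.secondCountable_of_separable X

/-- The support of the measure of an mm-space. -/
def supp (X : MMSpace.{u}) : Set X := X.μ.support

/-- The measure of an mm-space, seen as a measure on its support. -/
noncomputable def μsupp (X : MMSpace.{u}) : Measure X.supp := X.μ.comap Subtype.val

/-- Two mm-spaces are mm-isomorphic if there is a (bijective) isometry between the supports of
their measures that pushes the one measure forward to the other. -/
def Iso (X : MMSpace.{u}) (Y : MMSpace.{v}) : Prop :=
  ∃ e : X.supp ≃ᵢ Y.supp, X.μsupp.map e = Y.μsupp

/-- `X.Dom Y` (in symbols, `X ≺ Y`): there is a 1-Lipschitz map from `Y` to `X` pushing the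
measure of `Y` forward to that of `X`.  A space is identified with the support of its measure,
so the map has to be 1-Lipschitz on the support only; since the support is closed and has full
measure, such a map is automatically almost everywhere measurable, and its values outside the
support are irrelevant. -/
def Dom (X : MMSpace.{u}) (Y : MMSpace.{v}) : Prop :=
  ∃ f : Y → X, LipschitzOnWith 1 f Y.supp ∧ Y.μ.map f = X.μ

/-- The distortion of a subset of a product of two metric spaces (a value in `[0, ∞]`, equal to
`0` for the empty set). -/
noncomputable def distortion {X : Type u} {Y : Type v} [MetricSpace X] [MetricSpace Y]
    (S : Set (X × Y)) : ℝ≥0∞ :=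
  ⨆ p ∈ S, ⨆ q ∈ S, ENNReal.ofReal |dist p.1 q.1 - dist p.2 q.2|

/-- A coupling of the measures of two mm-spaces. -/
def IsCoupling (X : MMSpace.{u}) (Y : MMSpace.{v}) (π : Measure (X × Y)) : Prop :=
  π.fst = X.μ ∧ π.snd = Y.μ

/-- The box distance of two mm-spaces: the infimum of `max (dis S) (1 - π S)` over all couplings
`π` and all Borel subsets `S` of the product. -/
noncomputable def box (X : MMSpace.{u}) (Y : MMSpace.{v}) : ℝ≥0∞ :=
  ⨅ (π : Measure (X × Y)) (_ : IsCoupling X Y π) (S : Set (X × Y)) (_ : MeasurableSet S),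
    max (distortion S) (1 - π S)

theorem Iso.refl (X : MMSpace.{u}) : Iso X X :=
  ⟨IsometryEquiv.refl _, Measure.map_id⟩

theorem Iso.symm {X : MMSpace.{u}} {Y : MMSpace.{v}} : Iso X Y → Iso Y X := by
  rintro ⟨e, he⟩
  refine ⟨e.symm, ?_⟩
  rw [← he, Measure.map_map e.symm.continuous.measurable e.continuous.measurable]
  have : (e.symm ∘ e : X.supp → X.supp) = id := by
    funext x
    simp
  rw [this, Measure.map_id]

theorem Iso.trans {X : MMSpace.{u}} {Y : MMSpace.{v}} {Z : MMSpace.{w}} :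
    Iso X Y → Iso Y Z → Iso X Z := by
  rintro ⟨e, he⟩ ⟨g, hg⟩
  refine ⟨e.trans g, ?_⟩
  rw [← hg, ← he, Measure.map_map g.continuous.measurable e.continuous.measurable]
  rfl

theorem supp_nonempty (X : MMSpace.{u}) : X.supp.Nonempty :=
  Measure.nonempty_support (IsProbabilityMeasure.ne_zero X.μ)

theorem supp_mem_ae (X : MMSpace.{u}) : X.supp ∈ ae X.μ :=
  Measure.support_mem_ae

theorem measurableSet_supp (X : MMSpace.{u}) : MeasurableSet X.supp :=
  Measure.isClosed_support.measurableSet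

theorem map_μsupp (X : MMSpace.{u}) : X.μsupp.map Subtype.val = X.μ := by
  rw [μsupp, map_comap_subtype_coe X.measurableSet_supp]
  exact Measure.restrict_eq_self_of_ae_mem X.supp_mem_ae

/-- The maps between the ambient spaces that an mm-isomorphism gives. -/
theorem Iso.exists_maps {X : MMSpace.{u}} {Y : MMSpace.{v}} (h : Iso X Y) :
    ∃ (F : X → Y) (G : Y → X), Measurable F ∧ Measurable G ∧ X.μ.map F = Y.μ ∧
      (∀ x ∈ X.supp, F x ∈ Y.supp ∧ G (F x) = x) ∧ (∀ y ∈ Y.supp, G y ∈ X.supp) ∧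
      (∀ x ∈ X.supp, ∀ x' ∈ X.supp, dist (F x) (F x') = dist x x') ∧
      (∀ y ∈ Y.supp, ∀ y' ∈ Y.supp, dist (G y) (G y') = dist y y') := by
  classical
  obtain ⟨e, he⟩ := h
  obtain ⟨x₀, -⟩ := X.supp_nonempty
  obtain ⟨y₀, -⟩ := Y.supp_nonempty
  let F : X → Y := fun x => if h : x ∈ X.supp then (e ⟨x, h⟩ : Y) else y₀
  let G : Y → X := fun y => if h : y ∈ Y.supp then (e.symm ⟨y, h⟩ : X) else x₀
  have hF : ∀ x (h : x ∈ X.supp), F x = e ⟨x, h⟩ := fun x h => dif_pos h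
  have hG : ∀ y (h : y ∈ Y.supp), G y = e.symm ⟨y, h⟩ := fun y h => dif_pos h
  have mF : Measurable F :=
    Measurable.dite (measurable_subtype_coe.comp e.continuous.measurable) measurable_const
      X.measurableSet_supp
  have mG : Measurable G :=
    Measurable.dite (measurable_subtype_coe.comp e.symm.continuous.measurable) measurable_const
      Y.measurableSet_supp
  refine ⟨F, G, mF, mG, ?_, ?_, ?_, ?_, ?_⟩
  · rw [← X.map_μsupp, Measure.map_map mF measurable_subtype_coe, ← Y.map_μsupp, ← he,
      Measure.map_map measurable_subtype_coe e.continuous.measurable]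
    congr 1
    funext x
    exact hF x x.2
  · intro x hx
    rw [hF x hx]
    refine ⟨Subtype.coe_prop _, ?_⟩
    rw [hG _ (Subtype.coe_prop _)]
    simp
  · intro y hy
    rw [hG y hy]
    exact Subtype.coe_prop _
  · intro x hx x' hx'
    rw [hF x hx, hF x' hx', ← Subtype.dist_eq, e.dist_eq]
    rfl
  · intro y hy y' hy'
    rw [hG y hy, hG y' hy', ← Subtype.dist_eq, e.symm.dist_eq]
    rfl

theorem aemeasurable_of_lipschitzOn {X : MMSpace.{u}} {Y : MMSpace.{v}} {f : X → Y}
    (hf : LipschitzOnWith 1 f X.supp) : AEMeasurable f X.μ := by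
  have h := hf.continuousOn.aemeasurable (μ := X.μ) X.measurableSet_supp
  rwa [Measure.restrict_eq_self_of_ae_mem (s := X.supp) X.supp_mem_ae] at h

theorem mapsTo_supp {X : MMSpace.{u}} {Y : MMSpace.{v}} {f : X → Y}
    (hf : LipschitzOnWith 1 f X.supp) (hμ : X.μ.map f = Y.μ) : MapsTo f X.supp Y.supp := by
  intro x hx
  refine (Measure.mem_support_iff_forall _).2 fun U hU => ?_
  obtain ⟨V, hVU, hVo, hxV⟩ := mem_nhds_iff.1 hU
  refine lt_of_lt_of_le ?_ (measure_mono hVU)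
  rw [← hμ, Measure.map_apply_of_aemeasurable (aemeasurable_of_lipschitzOn hf) hVo.measurableSet]
  have h1 : f ⁻¹' V ∈ 𝓝[X.supp] x := hf.continuousOn x hx (hVo.mem_nhds hxV)
  obtain ⟨W, hW, hWV⟩ := mem_nhdsWithin_iff_exists_mem_nhds_inter.1 h1
  calc 0 < X.μ W := (Measure.mem_support_iff_forall _).1 hx W hW
    _ = X.μ (W ∩ X.supp) := by
        rw [inter_comm]; exact (Measure.measure_inter_eq_of_ae (t := X.supp) X.supp_mem_ae).symm
    _ ≤ X.μ (f ⁻¹' V) := measure_mono hWV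

theorem Iso.dom {X : MMSpace.{u}} {Y : MMSpace.{v}} (h : Iso X Y) : Dom Y X := by
  obtain ⟨F, G, -, -, hμ, -, -, hd, -⟩ := h.exists_maps
  exact ⟨F, LipschitzOnWith.of_dist_le_mul fun x hx y hy => by simp [hd x hx y hy], hμ⟩

theorem Dom.trans {X : MMSpace.{u}} {Y : MMSpace.{v}} {Z : MMSpace.{w}} :
    Dom X Y → Dom Y Z → Dom X Z := by
  rintro ⟨f, hf, hfμ⟩ ⟨g, hg, hgμ⟩
  refine ⟨f ∘ g, by simpa using hf.comp hg (mapsTo_supp hg hgμ), ?_⟩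
  rw [← hfμ, ← hgμ]
  refine (AEMeasurable.map_map_of_aemeasurable ?_ (aemeasurable_of_lipschitzOn hg)).symm
  rw [hgμ]
  exact aemeasurable_of_lipschitzOn hf

theorem box_le_of_iso {X X' : MMSpace.{u}} {Y Y' : MMSpace.{v}} (hX : Iso X X')
    (hY : Iso Y Y') : box X' Y' ≤ box X Y := by
  obtain ⟨F, F', mF, mF', hF, hFF', hF's, -, hF'd⟩ := hX.exists_maps
  obtain ⟨G, G', mG, mG', hG, hGG', hG's, -, hG'd⟩ := hY.exists_maps
  refine le_iInf₂ fun π hπ => le_iInf₂ fun S hS => ?_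
  have mFG : Measurable (Prod.map F G) := mF.prodMap mG
  have hfst : (π.map (Prod.map F G)).fst = X'.μ := by
    rw [Measure.fst, Measure.map_map measurable_fst mFG, ← hF, ← hπ.1, Measure.fst,
      Measure.map_map mF measurable_fst]
    rfl
  have hsnd : (π.map (Prod.map F G)).snd = Y'.μ := by
    rw [Measure.snd, Measure.map_map measurable_snd mFG, ← hG, ← hπ.2, Measure.snd,
      Measure.map_map mG measurable_snd]
    rfl
  have mS' : MeasurableSet ((X'.supp ×ˢ Y'.supp) ∩ Prod.map F' G' ⁻¹' S) :=
    (X'.measurableSet_supp.prod Y'.measurableSet_supp).inter (mF'.prodMap mG' hS)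
  refine (iInf₂_le_of_le _ ⟨hfst, hsnd⟩ (iInf₂_le _ mS')).trans ?_
  refine max_le_max ?_ (tsub_le_tsub_left ?_ 1)
  · refine iSup₂_le fun p hp => iSup₂_le fun q hq => ?_
    rw [← hF'd _ hp.1.1 _ hq.1.1, ← hG'd _ hp.1.2 _ hq.1.2]
    exact le_iSup₂_of_le (Prod.map F' G' p) hp.2
      (le_iSup₂_of_le (Prod.map F' G' q) hq.2 le_rfl)
  · rw [Measure.map_apply mFG mS']
    have h1 : ∀ᵐ p ∂π, p.1 ∈ X.supp := by
      have h : ∀ᵐ x ∂(π.map Prod.fst), x ∈ X.supp := by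
        have := hπ.1
        rw [Measure.fst] at this
        rw [this]
        exact X.supp_mem_ae
      exact ae_of_ae_map measurable_fst.aemeasurable h
    have h2 : ∀ᵐ p ∂π, p.2 ∈ Y.supp := by
      have h : ∀ᵐ y ∂(π.map Prod.snd), y ∈ Y.supp := by
        have := hπ.2
        rw [Measure.snd] at this
        rw [this]
        exact Y.supp_mem_ae
      exact ae_of_ae_map measurable_snd.aemeasurable h
    refine measure_mono_ae ?_
    filter_upwards [h1, h2] with p hp1 hp2 hpS
    refine ⟨⟨(hFF' _ hp1).1, (hGG' _ hp2).1⟩, ?_⟩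
    change (F' (F p.1), G' (G p.2)) ∈ S
    rw [(hFF' _ hp1).2, (hGG' _ hp2).2]
    exact hpS

instance setoid : Setoid MMSpace.{u} := ⟨Iso, Iso.refl, Iso.symm, Iso.trans⟩

end MMSpace

/-- The set of all mm-isomorphism classes of mm-spaces. -/
def MMClass : Type (u + 1) := Quotient MMSpace.setoid.{u}

namespace MMClass

/-- The mm-isomorphism class of an mm-space. -/
def mk (X : MMSpace.{u}) : MMClass.{u} := Quotient.mk _ X

/-- The Lipschitz order `x ≺ y` on mm-isomorphism classes. -/
def Dom : MMClass.{u} → MMClass.{u} → Prop :=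
  Quotient.lift₂ MMSpace.Dom fun _ _ _ _ h₁ h₂ => propext
    ⟨fun h => (h₁.dom.trans h).trans h₂.symm.dom, fun h => (h₁.symm.dom.trans h).trans h₂.dom⟩

/-- The box distance on mm-isomorphism classes. -/
noncomputable def box : MMClass.{u} → MMClass.{u} → ℝ≥0∞ :=
  Quotient.lift₂ MMSpace.box fun _ _ _ _ h₁ h₂ => le_antisymm
    (MMSpace.box_le_of_iso h₁.symm h₂.symm) (MMSpace.box_le_of_iso h₁ h₂)

/-- The box topology: a set is open if it contains a box-distance ball around each of its
points. -/
instance boxTopology : TopologicalSpace MMClass.{u} where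
  IsOpen U := ∀ x ∈ U, ∃ ε : ℝ≥0∞, 0 < ε ∧ ∀ y, box x y < ε → y ∈ U
  isOpen_univ := fun _ _ => ⟨1, one_pos, fun _ _ => mem_univ _⟩
  isOpen_inter := by
    intro U V hU hV x hx
    obtain ⟨ε, hε, h⟩ := hU x hx.1
    obtain ⟨δ, hδ, h'⟩ := hV x hx.2
    exact ⟨min ε δ, lt_min hε hδ, fun y hy =>
      ⟨h y (hy.trans_le (min_le_left _ _)), h' y (hy.trans_le (min_le_right _ _))⟩⟩
  isOpen_sUnion := by
    intro 𝒰 h x ⟨U, hU, hx⟩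
    obtain ⟨ε, hε, hb⟩ := h U hU x hx
    exact ⟨ε, hε, fun y hy => ⟨U, hU, hb y hy⟩⟩

end MMClass

/-- A pyramid: a nonempty, box-closed, downward closed and directed set of (classes of)
mm-spaces. -/
structure IsPyramid (P : Set MMClass.{u}) : Prop where
  nonempty : P.Nonempty
  isClosed : IsClosed P
  downward : ∀ x y, y ∈ P → MMClass.Dom x y → x ∈ P
  directed : ∀ x ∈ P, ∀ y ∈ P, ∃ z ∈ P, MMClass.Dom x z ∧ MMClass.Dom y z

/-- The index set `{1, …, N}` for finite `N`, and `{1, 2, …}` for `N = ∞`. -/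
abbrev Idx (N : ℕ∞) : Type := {n : ℕ // 1 ≤ n ∧ (n : ℕ∞) ≤ N}

/-- The sequences of length `N` in `(0, 1]` whose sum is `1`. -/
def weights (N : ℕ∞) : Set (Idx N → ℝ) :=
  {a | (∀ n, a n ∈ Ioc (0 : ℝ) 1) ∧ HasSum a 1}

/-- The direct sum of the sets `P n` of mm-spaces with weights `a n`: all `X` such that there are
mm-spaces `Y n` in `P n` and 1-Lipschitz maps `f n : Y n → X` (on the supports, as for the
Lipschitz order) with `μ_X = ∑ a n • (f n)_* μ_{Y n}`. -/
def directSum {N : ℕ∞} (a : Idx N → ℝ) (P : Idx N → Set MMClass.{u}) : Set MMClass.{u} :=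
  {x | ∃ X : MMSpace.{u}, MMClass.mk X = x ∧
    ∃ (Y : Idx N → MMSpace.{u}) (f : ∀ n, Y n → X),
      (∀ n, MMClass.mk (Y n) ∈ P n) ∧ (∀ n, LipschitzOnWith 1 (f n) (Y n).supp) ∧
      X.μ = Measure.sum fun n => ENNReal.ofReal (a n) • (Y n).μ.map (f n)}

/-! Three of the pyramid axioms are formal. A one-point space lies in the sum, 1-Lipschitz images
come from postcomposition, and two members are dominated by a measure on their product, whose
summands are images of common dominators in each `P n`.

Closedness is the substance. Let `X` be box-close to a member `Y` of the sum. Disintegrating a good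
coupling of `X` and `Y` over `Y` lifts the decomposition of the measure of `Y` to the coupling, and
hence to `X.μ = ∑ a n • ν n` (`exists_decomposition`). The same relation `S` shows that `(X, ν n)`
is close to `P n`, with error multiplied by at most `1 / a n`.

Now let the error tend to `0`. All the `ν n` live on the one space `X` and satisfy `ν n ≤ (a n)⁻¹ •
X.μ`, so they have setwise limits along an ultrafilter that are again measures
(`exists_setwise_limit`). Setwise convergence implies box convergence
(`eventually_box_withMeasure_lt`), so the limits lie in the closed sets `P n`. Their weighted sum is
still `X.μ`, and the identity maps exhibit `X` as a member of the sum. -/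

namespace MeasureTheory.Measure

open ProbabilityTheory Filter

/-! ### Constructions of couplings -/

section Coupling

variable {α : Type u} {β : Type v} {γ : Type w} [MeasurableSpace α] [MeasurableSpace β]
  [MeasurableSpace γ]

/-- A measure whose marginals are dominated by two probability measures extends to a coupling. -/
theorem exists_coupling_ge {μ : Measure α} {ν : Measure β} [IsProbabilityMeasure μ]
    [IsProbabilityMeasure ν] {σ : Measure (α × β)} (h₁ : σ.fst ≤ μ) (h₂ : σ.snd ≤ ν) :
    ∃ π : Measure (α × β), π.fst = μ ∧ π.snd = ν ∧ σ ≤ π := by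
  have f₁ : IsFiniteMeasure σ.fst := isFiniteMeasure_of_le μ h₁
  have f₂ : IsFiniteMeasure σ.snd := isFiniteMeasure_of_le ν h₂
  have e₁ : (μ - σ.fst) + σ.fst = μ := sub_add_cancel_of_le h₁
  have e₂ : (ν - σ.snd) + σ.snd = ν := sub_add_cancel_of_le h₂
  have g₁ : IsFiniteMeasure (μ - σ.fst) := isFiniteMeasure_of_le μ sub_le
  have g₂ : IsFiniteMeasure (ν - σ.snd) := isFiniteMeasure_of_le ν sub_le
  set μ' := μ - σ.fst
  set ν' := ν - σ.snd
  have hmass : μ' univ = ν' univ := by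
    have k₁ : μ' univ + σ univ = 1 := by
      have := congrArg (fun m => m univ) e₁
      simpa [Measure.fst_univ] using this
    have k₂ : ν' univ + σ univ = 1 := by
      have := congrArg (fun m => m univ) e₂
      simpa [Measure.snd_univ] using this
    have hσ : σ univ ≠ ∞ := by
      rw [← Measure.fst_univ]
      exact measure_ne_top _ _
    exact (ENNReal.add_left_inj hσ).1 (k₁.trans k₂.symm)
  -- The missing marginals have equal mass. The normalised product of the two supplies them, unless
  -- that mass is zero and `σ` is already a coupling.
  by_cases h0 : μ' univ = 0
  · have z₁ : μ' = 0 := measure_univ_eq_zero.1 h0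
    have z₂ : ν' = 0 := measure_univ_eq_zero.1 (hmass ▸ h0)
    exact ⟨σ, by simpa [z₁] using e₁, by simpa [z₂] using e₂, le_rfl⟩
  · have ht : μ' univ ≠ ∞ := measure_ne_top _ _
    refine ⟨(μ' univ)⁻¹ • μ'.prod ν' + σ, ?_, ?_, Measure.le_add_left le_rfl⟩
    · rw [Measure.fst_add, Measure.fst, Measure.map_smul, Measure.map_fst_prod, ← hmass, smul_smul,
        ENNReal.inv_mul_cancel h0 ht, one_smul, e₁]
    · rw [Measure.snd_add, Measure.snd, Measure.map_smul, Measure.map_snd_prod, smul_smul,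
        ENNReal.inv_mul_cancel h0 ht, one_smul, e₂]

/-- The gluing lemma: couplings with a common marginal come from a measure on the triple product. -/
theorem exists_gluing [StandardBorelSpace γ] [Nonempty γ] {π : Measure (α × β)}
    {σ : Measure (β × γ)} [IsFiniteMeasure π] [IsFiniteMeasure σ] (h : π.snd = σ.fst) :
    ∃ τ : Measure ((α × β) × γ), τ.map Prod.fst = π ∧ τ.map (fun p => (p.1.2, p.2)) = σ := by
  -- The outer coordinates are made conditionally independent given the middle one.
  refine ⟨π ⊗ₘ σ.condKernel.comap Prod.snd measurable_snd, ?_, ?_⟩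
  · exact Measure.fst_compProd _ _
  · have hm : Measurable (fun p : (α × β) × γ => (p.1.2, p.2)) := by fun_prop
    ext s hs
    conv_rhs => rw [← σ.disintegrate σ.condKernel, ← h, Measure.compProd_apply hs, Measure.snd,
      lintegral_map (Kernel.measurable_kernel_prodMk_left hs) measurable_snd]
    rw [Measure.map_apply hm hs, Measure.compProd_apply (hm hs)]
    rfl

/-- A decomposition of the second marginal of a coupling lifts to the coupling. -/
theorem exists_sum_coupling [StandardBorelSpace α] [Nonempty α] {ι : Type w} [Countable ι]
    {π : Measure (α × β)} [IsFiniteMeasure π] {c : ι → ℝ≥0∞} {ν : ι → Measure β}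
    [∀ i, IsFiniteMeasure (ν i)] (h : π.snd = Measure.sum fun i => c i • ν i) :
    ∃ ρ : ι → Measure (α × β), (∀ i, (ρ i).snd = ν i) ∧ π = Measure.sum fun i => c i • ρ i := by
  have : IsFiniteMeasure (π.map Prod.swap) := inferInstance
  -- Conditional law of the first coordinate given the second; composing it with a measure on `β` is
  -- linear in that measure.
  let κ := (π.map Prod.swap).condKernel
  refine ⟨fun i => (ν i ⊗ₘ κ).map Prod.swap, fun i => ?_, ?_⟩
  · rw [Measure.snd_map_swap, Measure.fst_compProd]
  · have e : π.map Prod.swap = Measure.sum fun i => c i • (ν i ⊗ₘ κ) := by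
      rw [← (π.map Prod.swap).disintegrate κ, Measure.fst_map_swap, h,
        Measure.compProd_sum_left]
      simp only [Measure.compProd_smul_left]
    have e' := congrArg (Measure.map Prod.swap) e
    rw [Measure.map_map measurable_swap measurable_swap, Prod.swap_swap_eq, Measure.map_id,
      Measure.map_sum measurable_swap.aemeasurable] at e'
    simpa only [Measure.map_smul] using e'

end Coupling

/-! ### Setwise limits of measures -/

/-- Setwise limits along an ultrafilter of uniformly dominated measures exist. -/
theorem exists_setwise_limit {α : Type u} [MeasurableSpace α] {μ : Measure α} [IsFiniteMeasure μ]
    {c : ℝ≥0∞} (hc : c ≠ ∞) {κ : Type v} (F : Ultrafilter κ) (ν : κ → Measure α)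
    (hν : ∀ k, ν k ≤ c • μ) :
    ∃ ν' : Measure α, ∀ s, MeasurableSet s → Tendsto (fun k => ν k s) F (𝓝 (ν' s)) := by
  -- Compactness of `[0, ∞]`: every ultrafilter on it converges.
  have hlim : ∀ s, Tendsto (fun k => ν k s) F (𝓝 ((F.map fun k => ν k s).lim)) := fun s =>
    (F.map fun k => ν k s).le_nhds_lim
  have hle : ∀ k s, ν k s ≤ c * μ s := fun k s => hν k s
  have hfin : ∀ s, c * μ s ≠ ∞ := fun s => ENNReal.mul_ne_top hc (measure_ne_top _ _)
  have hlim_le : ∀ s, (F.map fun k => ν k s).lim ≤ c * μ s := fun s =>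
    le_of_tendsto' (hlim s) fun k => hle k s
  refine ⟨Measure.ofMeasurable (fun s _ => (F.map fun k => ν k s).lim) ?_ ?_, fun s hs => ?_⟩
  · simpa using hlim_le ∅
  · intro f hf hd
    refine tendsto_nhds_unique (hlim _) ?_
    -- Countable additivity survives the limit because `c * μ (f i)` is a summable bound, uniform in
    -- `k`.
    have hsum : ∑' i, c * μ (f i) ≠ ∞ := by
      rw [ENNReal.tsum_mul_left, ← measure_iUnion hd hf]
      exact hfin _
    have key := tendsto_tsum_of_dominated_convergence (𝓕 := (F : Filter κ))
      (f := fun k i => (ν k (f i)).toReal) (g := fun i => ((F.map fun k => ν k (f i)).lim).toReal)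
      (bound := fun i => (c * μ (f i)).toReal) (ENNReal.summable_toReal hsum)
      (fun i => (ENNReal.tendsto_toReal_iff
        (fun k => ne_top_of_le_ne_top (hfin _) (hle k _))
        (ne_top_of_le_ne_top (hfin _) (hlim_le _))).2 (hlim _))
      (Eventually.of_forall fun k i => by
        rw [Real.norm_of_nonneg ENNReal.toReal_nonneg]
        exact ENNReal.toReal_mono (hfin _) (hle k _))
    rw [← ENNReal.tsum_toReal_eq fun i => ne_top_of_le_ne_top (hfin _) (hlim_le _)] at key
    simp only [← ENNReal.tsum_toReal_eq
      fun i => ne_top_of_le_ne_top (hfin (f i)) (hle _ _), ← measure_iUnion hd hf] at key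
    refine (ENNReal.tendsto_toReal_iff
      (fun k => ne_top_of_le_ne_top (hfin _) (hle k _)) ?_).1 key
    exact ne_top_of_le_ne_top hsum (ENNReal.tsum_le_tsum fun i => hlim_le _)
  · rw [Measure.ofMeasurable_apply s hs]
    exact hlim s

end MeasureTheory.Measure

theorem MeasureTheory.Measure.sum_mono {α : Type u} [MeasurableSpace α] {ι : Type v}
    {μ ν : ι → Measure α} (h : ∀ i, μ i ≤ ν i) : Measure.sum μ ≤ Measure.sum ν :=
  Measure.le_iff.2 fun s hs => by
    rw [Measure.sum_apply _ hs, Measure.sum_apply _ hs]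
    exact ENNReal.tsum_le_tsum fun i => h i s

/-! ### The triangle inequality for the box distance -/

namespace MMSpace

open Filter

theorem box_le {X : MMSpace.{u}} {Y : MMSpace.{v}} {π : Measure (X × Y)} (hπ : IsCoupling X Y π)
    {S : Set (X × Y)} (hS : MeasurableSet S) : box X Y ≤ max (distortion S) (1 - π S) :=
  iInf₂_le_of_le π hπ (iInf₂_le S hS)

theorem exists_of_box_lt {X : MMSpace.{u}} {Y : MMSpace.{v}} {ε : ℝ≥0∞} (h : box X Y < ε) :
    ∃ (π : Measure (X × Y)) (S : Set (X × Y)), IsCoupling X Y π ∧ MeasurableSet S ∧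
      distortion S < ε ∧ 1 - π S < ε := by
  simp only [box, iInf_lt_iff, max_lt_iff] at h
  obtain ⟨π, hπ, S, hS, h₁, h₂⟩ := h
  exact ⟨π, S, hπ, hS, h₁, h₂⟩

theorem IsCoupling.isProbabilityMeasure {X : MMSpace.{u}} {Y : MMSpace.{v}}
    {π : Measure (X × Y)} (hπ : IsCoupling X Y π) : IsProbabilityMeasure π :=
  ⟨by rw [← Measure.fst_univ, hπ.1]; exact measure_univ⟩

theorem le_distortion {X : Type u} {Y : Type v} [MetricSpace X] [MetricSpace Y]
    {S : Set (X × Y)} {p q : X × Y} (hp : p ∈ S) (hq : q ∈ S) :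
    ENNReal.ofReal |dist p.1 q.1 - dist p.2 q.2| ≤ distortion S :=
  le_iSup₂_of_le p hp (le_iSup₂_of_le q hq le_rfl)

/-- A composite of Borel relations is a projection and need not be Borel. Its closure is, and costs
no distortion because distances are continuous. -/
theorem distortion_closure_le {X : Type u} {Y : Type v} [MetricSpace X] [MetricSpace Y]
    (S : Set (X × Y)) : distortion (closure S) ≤ distortion S := by
  have hc : Continuous fun r : (X × Y) × (X × Y) =>
      ENNReal.ofReal |dist r.1.1 r.2.1 - dist r.1.2 r.2.2| :=
    ENNReal.continuous_ofReal.comp (by fun_prop)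
  have hcl : IsClosed {r : (X × Y) × (X × Y) |
      ENNReal.ofReal |dist r.1.1 r.2.1 - dist r.1.2 r.2.2| ≤ distortion S} :=
    isClosed_le hc continuous_const
  have hsub : S ×ˢ S ⊆ {r : (X × Y) × (X × Y) |
      ENNReal.ofReal |dist r.1.1 r.2.1 - dist r.1.2 r.2.2| ≤ distortion S} := by
    rintro ⟨p, q⟩ ⟨hp, hq⟩
    exact le_distortion hp hq
  have h := closure_minimal hsub hcl
  rw [closure_prod_eq] at h
  exact iSup₂_le fun p hp => iSup₂_le fun q hq => h (mk_mem_prod hp hq)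

theorem distortion_comp_le {X : Type u} {Y : Type v} {Z : Type w} [MetricSpace X] [MetricSpace Y]
    [MetricSpace Z] (S : Set (X × Y)) (T : Set (Y × Z)) :
    distortion {r : X × Z | ∃ y, (r.1, y) ∈ S ∧ (y, r.2) ∈ T} ≤ distortion S + distortion T := by
  refine iSup₂_le fun p ⟨y, hpS, hpT⟩ => iSup₂_le fun q ⟨y', hqS, hqT⟩ => ?_
  have h₁ : ENNReal.ofReal |dist p.1 q.1 - dist y y'| ≤ distortion S :=
    le_distortion hpS hqS
  have h₂ : ENNReal.ofReal |dist y y' - dist p.2 q.2| ≤ distortion T :=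
    le_distortion hpT hqT
  refine le_trans ?_ (add_le_add h₁ h₂)
  rw [← ENNReal.ofReal_add (abs_nonneg _) (abs_nonneg _)]
  exact ENNReal.ofReal_le_ofReal (abs_sub_le _ _ _)

/-- Glue two near-optimal couplings along `Y` and compose their relations: distortions add, and so
do the masses left uncovered. -/
theorem box_triangle (X : MMSpace.{u}) (Y : MMSpace.{v}) (Z : MMSpace.{w}) :
    box X Z ≤ box X Y + box Y Z := by
  refine ENNReal.le_of_forall_pos_le_add fun ε hε hlt => ?_
  have hε2 : (ε : ℝ≥0∞) / 2 ≠ 0 := by simpa using hε.ne'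
  obtain ⟨hX, hY⟩ := ENNReal.add_lt_top.1 hlt
  obtain ⟨π, S, hπ, hS, hdS, hmS⟩ := exists_of_box_lt (ENNReal.lt_add_right hX.ne hε2)
  obtain ⟨σ, T, hσ, hT, hdT, hmT⟩ := exists_of_box_lt (ENNReal.lt_add_right hY.ne hε2)
  have := hπ.isProbabilityMeasure
  have := hσ.isProbabilityMeasure
  have : Nonempty Z := Z.supp_nonempty.to_type
  obtain ⟨τ, hτ₁, hτ₂⟩ := Measure.exists_gluing (hπ.2.trans hσ.1.symm)
  have hτp : IsProbabilityMeasure τ := ⟨by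
    rw [← measure_univ (μ := π), ← hτ₁, Measure.map_apply measurable_fst MeasurableSet.univ,
      preimage_univ]⟩
  have m₂ : Measurable fun p : (X × Y) × Z => (p.1.2, p.2) := by fun_prop
  have m₃ : Measurable fun p : (X × Y) × Z => (p.1.1, p.2) := by fun_prop
  set R : Set (X × Z) := {r | ∃ y, (r.1, y) ∈ S ∧ (y, r.2) ∈ T}
  have hcoup : IsCoupling X Z (τ.map fun p => (p.1.1, p.2)) := by
    constructor
    · rw [← hπ.1, ← hτ₁, Measure.fst, Measure.fst, Measure.map_map measurable_fst m₃,
        Measure.map_map measurable_fst measurable_fst]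
      rfl
    · rw [← hσ.2, ← hτ₂, Measure.snd, Measure.snd, Measure.map_map measurable_snd m₃,
        Measure.map_map measurable_snd m₂]
      rfl
  have hsum : box X Y + ε / 2 + (box Y Z + ε / 2) = box X Y + box Y Z + ε := by
    rw [add_add_add_comm, ENNReal.add_halves]
  refine (box_le hcoup isClosed_closure.measurableSet (S := closure R)).trans (max_le ?_ ?_)
  · rw [← hsum]
    exact (distortion_closure_le R).trans
      ((distortion_comp_le S T).trans (add_le_add hdS.le hdT.le))
  · have hcm : 1 - (τ.map fun p => (p.1.1, p.2)) (closure R) ≤ (1 - π S) + (1 - σ T) := by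
      have := hcoup.isProbabilityMeasure
      rw [← prob_compl_eq_one_sub isClosed_closure.measurableSet, ← prob_compl_eq_one_sub hS,
        ← prob_compl_eq_one_sub hT, ← hτ₁, ← hτ₂, Measure.map_apply measurable_fst hS.compl,
        Measure.map_apply m₂ hT.compl,
        Measure.map_apply m₃ isClosed_closure.measurableSet.compl]
      refine (measure_mono ?_).trans (measure_union_le _ _)
      intro p hp
      by_contra hcon
      simp only [mem_union, mem_preimage, mem_compl_iff, not_or, not_not] at hcon
      exact hp (subset_closure ⟨p.1.2, hcon.1, hcon.2⟩)
    rw [← hsum]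
    exact hcm.trans (add_le_add hmS.le hmT.le)

/-! ### Box distance between measures on one space -/

/-- The mm-space obtained by changing the measure of `X`. -/
abbrev withMeasure (X : MMSpace.{u}) (ν : ProbabilityMeasure X) : MMSpace.{u} :=
  MMSpace.mk X (ν : Measure X)

/-- A separable metric space has countable measurable partitions of arbitrarily small mesh. -/
theorem exists_partition (X : Type u) [MetricSpace X] [SecondCountableTopology X]
    [MeasurableSpace X] [BorelSpace X] {r : ℝ} (hr : 0 < r) :
    ∃ A : ℕ → Set X, (∀ i, MeasurableSet (A i)) ∧ Pairwise (Function.onFun Disjoint A) ∧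
      (⋃ i, A i) = univ ∧ ∀ i, ∀ x ∈ A i, ∀ y ∈ A i, dist x y ≤ r := by
  rcases isEmpty_or_nonempty X with hX | hX
  · exact ⟨fun _ => ∅, fun _ => .empty, fun _ _ _ => disjoint_bot_left,
      Subsingleton.elim _ _, fun _ x => (hX.false x).elim⟩
  · let B : ℕ → Set X := fun i => Metric.ball (TopologicalSpace.denseSeq X i) (r / 2)
    refine ⟨disjointed B, fun i => .disjointed (fun _ => Metric.isOpen_ball.measurableSet) i,
      disjoint_disjointed B, ?_, fun i x hx y hy => ?_⟩
    · rw [iUnion_disjointed, eq_univ_iff_forall]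
      intro x
      obtain ⟨i, hi⟩ := (TopologicalSpace.denseRange_denseSeq X).exists_dist_lt x (half_pos hr)
      exact mem_iUnion.2 ⟨i, hi⟩
    · have hx' := Metric.mem_ball.1 (disjointed_subset B i hx)
      have hy' := Metric.mem_ball.1 (disjointed_subset B i hy)
      linarith [dist_triangle_right x y (TopologicalSpace.denseSeq X i)]

/-- Two measures on the same space that nearly agree on the pieces of a partition of small mesh
are close in the box distance. -/
theorem box_withMeasure_le (X : MMSpace.{u}) (ν ν' : ProbabilityMeasure X) {A : ℕ → Set X}
    (hA : ∀ i, MeasurableSet (A i)) (hd : Pairwise (Function.onFun Disjoint A))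
    (hU : (⋃ i, A i) = univ) {r : ℝ} (hr : ∀ i, ∀ x ∈ A i, ∀ y ∈ A i, dist x y ≤ r) :
    box (X.withMeasure ν) (X.withMeasure ν') ≤
      max (ENNReal.ofReal (2 * r))
        (1 - ∑' i, min ((ν : Measure X) (A i)) ((ν' : Measure X) (A i))) := by
  set m : Measure X := ν.toMeasure
  set m' : Measure X := ν'.toMeasure
  -- Dividing by the larger of the two masses keeps both marginals below `m` and `m'`, and leaves
  -- mass `min (m (A i)) (m' (A i))` on `A i ×ˢ A i`.
  let σ : Measure (X × X) := Measure.sum fun i =>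
    (max (m (A i)) (m' (A i)))⁻¹ • (m.restrict (A i)).prod (m'.restrict (A i))
  have hinv : ∀ a b c : ℝ≥0∞, a ≤ c → (c⁻¹ * a) • b ≤ b := fun a b c hac => by
    rw [smul_eq_mul]
    exact mul_le_of_le_one_left' ((mul_le_mul_right hac _).trans (ENNReal.inv_mul_le_one c))
  have hsum : ∀ ρ : Measure X, Measure.sum (fun i => ρ.restrict (A i)) = ρ := fun ρ => by
    rw [← Measure.restrict_iUnion hd hA, hU, Measure.restrict_univ]
  have h₁ : σ.fst ≤ m := by
    conv_rhs => rw [← hsum m]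
    rw [Measure.fst_sum]
    refine Measure.sum_mono fun i => ?_
    rw [Measure.fst, Measure.map_smul, Measure.map_fst_prod, smul_smul, Measure.restrict_apply_univ]
    exact fun s => hinv _ _ _ (le_max_right _ _)
  have h₂ : σ.snd ≤ m' := by
    conv_rhs => rw [← hsum m']
    rw [Measure.snd_sum]
    refine Measure.sum_mono fun i => ?_
    rw [Measure.snd, Measure.map_smul, Measure.map_snd_prod, smul_smul, Measure.restrict_apply_univ]
    exact fun s => hinv _ _ _ (le_max_left _ _)
  obtain ⟨π, hπ₁, hπ₂, hσπ⟩ := Measure.exists_coupling_ge h₁ h₂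
  have mS : MeasurableSet (⋃ i, A i ×ˢ A i) := .iUnion fun i => (hA i).prod (hA i)
  refine (box_le (X := X.withMeasure ν) (Y := X.withMeasure ν') ⟨hπ₁, hπ₂⟩ mS).trans
    (max_le_max ?_ (tsub_le_tsub_left ?_ 1))
  · refine iSup₂_le fun p hp => iSup₂_le fun q hq => ENNReal.ofReal_le_ofReal ?_
    obtain ⟨i, hi⟩ := mem_iUnion.1 hp
    obtain ⟨j, hj⟩ := mem_iUnion.1 hq
    have e₁ := hr i _ hi.1 _ hi.2
    have e₂ := hr j _ hj.1 _ hj.2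
    have := dist_dist_dist_le p.1 q.1 p.2 q.2
    rw [Real.dist_eq] at this
    linarith
  · refine le_trans ?_ (hσπ _)
    rw [Measure.sum_apply _ mS]
    refine ENNReal.tsum_le_tsum fun i => ?_
    rw [Measure.smul_apply, smul_eq_mul]
    have hge : m (A i) * m' (A i) ≤
        ((m.restrict (A i)).prod (m'.restrict (A i))) (⋃ i, A i ×ˢ A i) := by
      refine le_trans (le_of_eq ?_) (measure_mono (subset_iUnion (fun i => A i ×ˢ A i) i))
      rw [Measure.prod_prod, Measure.restrict_apply_self, Measure.restrict_apply_self]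
    refine le_trans ?_ (mul_le_mul_right hge _)
    rw [← max_mul_min (m (A i)), ← mul_assoc]
    by_cases h0 : max (m (A i)) (m' (A i)) = 0
    · have : min (m (A i)) (m' (A i)) = 0 := le_antisymm (h0 ▸ min_le_max) zero_le
      simp [this]
    · rw [ENNReal.inv_mul_cancel h0 (max_lt (measure_lt_top _ _) (measure_lt_top _ _)).ne, one_mul]

/-- Setwise convergence of the measures implies box convergence of the mm-spaces. -/
theorem eventually_box_withMeasure_lt (X : MMSpace.{u}) {κ : Type v} {l : Filter κ}
    {ν : ProbabilityMeasure X} {ν' : κ → ProbabilityMeasure X}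
    (h : ∀ s, MeasurableSet s →
      Tendsto (fun k => (ν' k : Measure X) s) l (𝓝 ((ν : Measure X) s)))
    {ε : ℝ≥0∞} (hε : 0 < ε) :
    ∀ᶠ k in l, box (X.withMeasure ν) (X.withMeasure (ν' k)) < ε := by
  obtain ⟨r, hr, hrε⟩ : ∃ r : ℝ, 0 < r ∧ ENNReal.ofReal (2 * r) < ε := by
    -- `ε` may be `∞`, so the mesh is taken from a finite `δ` below it.
    obtain ⟨δ, hδ, hδε⟩ := ENNReal.lt_iff_exists_nnreal_btwn.1 hε
    refine ⟨δ / 2, by simpa using hδ, ?_⟩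
    rwa [mul_div_cancel₀ _ two_ne_zero, ENNReal.ofReal_coe_nnreal]
  obtain ⟨A, hA, hd, hU, hAr⟩ := exists_partition X hr
  have hsum : ∑' i, (ν : Measure X) (A i) = 1 := by
    rw [← measure_iUnion hd hA, hU, measure_univ]
  have hne : ∀ (ρ : Measure X) [IsProbabilityMeasure ρ] i, min ((ν : Measure X) (A i)) (ρ (A i)) ≠ ∞ :=
    fun ρ _ i => ((min_le_left _ _).trans_lt (measure_lt_top _ _)).ne
  -- As in Scheffé's lemma, the minima are dominated by the summable masses `ν (A i)`, so their sum
  -- tends to the full mass.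
  have key : Tendsto (fun k => ∑' i, min ((ν : Measure X) (A i)) ((ν' k : Measure X) (A i))) l
      (𝓝 1) := by
    have := tendsto_tsum_of_dominated_convergence (𝓕 := l)
      (f := fun k i => (min ((ν : Measure X) (A i)) ((ν' k : Measure X) (A i))).toReal)
      (g := fun i => ((ν : Measure X) (A i)).toReal)
      (bound := fun i => ((ν : Measure X) (A i)).toReal)
      (ENNReal.summable_toReal (by simp [hsum]))
      (fun i => (ENNReal.tendsto_toReal_iff (fun k => hne _ i) (measure_ne_top _ _)).2 (by
        simpa using
          (tendsto_const_nhds (x := (ν : Measure X) (A i))).min (h (A i) (hA i))))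
      (Eventually.of_forall fun k i => by
        rw [Real.norm_of_nonneg ENNReal.toReal_nonneg]
        exact ENNReal.toReal_mono (measure_ne_top _ _) (min_le_left _ _))
    rw [← ENNReal.tsum_toReal_eq fun i => measure_ne_top _ _, hsum] at this
    simp only [← ENNReal.tsum_toReal_eq fun i => hne _ i] at this
    refine (ENNReal.tendsto_toReal_iff (fun k => ?_) ENNReal.one_ne_top).1 this
    exact ne_top_of_le_ne_top (hsum ▸ ENNReal.one_ne_top)
      (ENNReal.tsum_le_tsum fun i => min_le_left _ _)
  have key' := ENNReal.Tendsto.sub (tendsto_const_nhds (x := (1 : ℝ≥0∞))) key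
    (Or.inl ENNReal.one_ne_top)
  rw [tsub_self] at key'
  filter_upwards [key'.eventually (gt_mem_nhds hε)] with k hk
  exact (X.box_withMeasure_le ν (ν' k) hA hd hU hAr).trans_lt (max_lt hrε hk)

end MMSpace

/-! ### Supports, dominated summands and weights -/

open Filter

namespace MMSpace

theorem isProbabilityMeasure_map {X : MMSpace.{u}} {Y : MMSpace.{v}} {f : X → Y}
    (hf : LipschitzOnWith 1 f X.supp) : IsProbabilityMeasure (X.μ.map f) :=
  Measure.isProbabilityMeasure_map (aemeasurable_of_lipschitzOn hf)

/-- A Lipschitz map whose image measure is absolutely continuous with respect to the measure of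
the target maps support to support. -/
theorem mapsTo_supp_of_absolutelyContinuous {X : MMSpace.{u}} {Y : MMSpace.{v}} {f : X → Y}
    (hf : LipschitzOnWith 1 f X.supp) (hac : X.μ.map f ≪ Y.μ) : MapsTo f X.supp Y.supp := by
  have := isProbabilityMeasure_map hf
  let W : MMSpace.{v} := Y.withMeasure ⟨X.μ.map f, this⟩
  have h : MapsTo f X.supp W.supp := mapsTo_supp (Y := W) hf rfl
  exact h.mono_right hac.support_mono

end MMSpace

/-- One term of a sum of measures is at most the sum. This domination gives absolute continuity of
the pieces, the scaled error bound, and the existence of limits. -/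
theorem MeasureTheory.Measure.le_smul_of_eq_sum {α : Type u} [MeasurableSpace α] {ι : Type v}
    {c : ι → ℝ≥0∞} {μ : Measure α} {ν : ι → Measure α} (h : μ = Measure.sum fun i => c i • ν i)
    {i : ι} (h0 : c i ≠ 0) (ht : c i ≠ ∞) : ν i ≤ (c i)⁻¹ • μ := by
  intro s
  have := Measure.le_sum (fun i => c i • ν i) i s
  rw [← h, Measure.smul_apply, smul_eq_mul] at this
  rw [Measure.smul_apply, smul_eq_mul, mul_comm, ← div_eq_mul_inv, ENNReal.le_div_iff_mul_le
    (Or.inl h0) (Or.inl ht), mul_comm]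
  exact this

namespace weights

variable {N : ℕ∞} {a : Idx N → ℝ}

theorem ofReal_ne_zero (ha : a ∈ weights N) (n : Idx N) : ENNReal.ofReal (a n) ≠ 0 :=
  (ENNReal.ofReal_pos.2 (ha.1 n).1).ne'

theorem ofReal_le_one (ha : a ∈ weights N) (n : Idx N) : ENNReal.ofReal (a n) ≤ 1 :=
  ENNReal.ofReal_le_one.2 (ha.1 n).2

theorem tsum_ofReal (ha : a ∈ weights N) : ∑' n, ENNReal.ofReal (a n) = 1 := by
  rw [← ENNReal.ofReal_tsum_of_nonneg (fun n => (ha.1 n).1.le) ha.2.summable, ha.2.tsum_eq,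
    ENNReal.ofReal_one]

theorem isProbabilityMeasure_sum (ha : a ∈ weights N) {α : Type u} [MeasurableSpace α]
    (ν : Idx N → Measure α) [∀ n, IsProbabilityMeasure (ν n)] :
    IsProbabilityMeasure (Measure.sum fun n => ENNReal.ofReal (a n) • ν n) :=
  ⟨by simp [Measure.sum_apply _ MeasurableSet.univ, tsum_ofReal ha]⟩

end weights

/-! ### The pyramid axioms for the direct sum -/

namespace directSum

variable {N : ℕ∞} {a : Idx N → ℝ} {P : Idx N → Set MMClass.{u}}

theorem nonempty (ha : a ∈ weights N) (hP : ∀ n, (P n).Nonempty) : (directSum a P).Nonempty := by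
  have : ∀ n, ∃ Y : MMSpace.{u}, MMClass.mk Y ∈ P n := fun n => by
    obtain ⟨y, hy⟩ := hP n
    obtain ⟨Y, rfl⟩ := Quotient.exists_rep y
    exact ⟨Y, hy⟩
  choose Y hY using this
  have hf : ∀ n, LipschitzOnWith 1 (fun _ : Y n => PUnit.unit.{u + 1}) (Y n).supp := fun n =>
    (LipschitzWith.const' _).lipschitzOnWith
  have hp : ∀ n, IsProbabilityMeasure ((Y n).μ.map fun _ => PUnit.unit.{u + 1}) := fun n =>
    Measure.isProbabilityMeasure_map measurable_const.aemeasurable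
  have := weights.isProbabilityMeasure_sum ha fun n => (Y n).μ.map fun _ => PUnit.unit.{u + 1}
  let X : MMSpace.{u} :=
    { carrier := PUnit.{u + 1}
      μ := Measure.sum fun n => ENNReal.ofReal (a n) • (Y n).μ.map fun _ => PUnit.unit.{u + 1} }
  exact ⟨MMClass.mk X, X, rfl, Y, fun _ _ => PUnit.unit, hY, hf, rfl⟩

theorem downward (ha : a ∈ weights N) {x y : MMClass.{u}} (hy : y ∈ directSum a P)
    (hxy : MMClass.Dom x y) : x ∈ directSum a P := by
  obtain ⟨Y, rfl, Z, f, hZ, hf, hμ⟩ := hy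
  obtain ⟨X, rfl⟩ := Quotient.exists_rep x
  obtain ⟨g, hg, hgμ⟩ : MMSpace.Dom X Y := hxy
  -- `g` is controlled only on `Y.supp`, so each `f n` must map support into it for the composite to
  -- be 1-Lipschitz.
  have hac : ∀ n, (Z n).μ.map (f n) ≪ Y.μ := fun n =>
    Measure.absolutelyContinuous_of_le_smul (Measure.le_smul_of_eq_sum hμ
      (weights.ofReal_ne_zero ha n) ENNReal.ofReal_ne_top)
  have hgm := MMSpace.aemeasurable_of_lipschitzOn hg
  refine ⟨X, rfl, Z, fun n => g ∘ f n, hZ, fun n => by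
    simpa using hg.comp (hf n) (MMSpace.mapsTo_supp_of_absolutelyContinuous (hf n) (hac n)), ?_⟩
  rw [← hgμ]
  conv_lhs => rw [hμ]
  rw [Measure.map_sum (by rwa [← hμ])]
  congr 1
  funext n
  rw [Measure.map_smul, AEMeasurable.map_map_of_aemeasurable (hgm.mono_ac (hac n))
    (MMSpace.aemeasurable_of_lipschitzOn (hf n))]

/-- The product carries the sup metric, so pairing two 1-Lipschitz maps stays 1-Lipschitz, and so
are both projections. -/
theorem directed (ha : a ∈ weights N) (hP : ∀ n, IsPyramid (P n)) {x y : MMClass.{u}}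
    (hx : x ∈ directSum a P) (hy : y ∈ directSum a P) :
    ∃ z ∈ directSum a P, MMClass.Dom x z ∧ MMClass.Dom y z := by
  obtain ⟨X, rfl, X', f, hX', hf, hXμ⟩ := hx
  obtain ⟨Y, rfl, Y', g, hY', hg, hYμ⟩ := hy
  have : ∀ n, ∃ Z : MMSpace.{u}, MMClass.mk Z ∈ P n ∧ MMSpace.Dom (X' n) Z ∧
      MMSpace.Dom (Y' n) Z := fun n => by
    obtain ⟨z, hz, h₁, h₂⟩ := (hP n).directed _ (hX' n) _ (hY' n)
    obtain ⟨Z, rfl⟩ := Quotient.exists_rep z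
    exact ⟨Z, hz, h₁, h₂⟩
  choose Z hZ hXZ hYZ using this
  choose p hp hpμ using hXZ
  choose q hq hqμ using hYZ
  have hfp : ∀ n, LipschitzOnWith 1 (f n ∘ p n) (Z n).supp := fun n => by
    simpa using (hf n).comp (hp n) (MMSpace.mapsTo_supp (hp n) (hpμ n))
  have hgq : ∀ n, LipschitzOnWith 1 (g n ∘ q n) (Z n).supp := fun n => by
    simpa using (hg n).comp (hq n) (MMSpace.mapsTo_supp (hq n) (hqμ n))
  let F : ∀ n, Z n → X × Y := fun n z => ((f n ∘ p n) z, (g n ∘ q n) z)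
  have hF : ∀ n, LipschitzOnWith 1 (F n) (Z n).supp := fun n => by
    have := (hfp n).prodMk (hgq n)
    rwa [max_self] at this
  have hFm : ∀ n, AEMeasurable (F n) (Z n).μ := fun n =>
    (MMSpace.aemeasurable_of_lipschitzOn (hfp n)).prodMk
      (MMSpace.aemeasurable_of_lipschitzOn (hgq n))
  have : ∀ n, IsProbabilityMeasure ((Z n).μ.map (F n)) := fun n =>
    Measure.isProbabilityMeasure_map (hFm n)
  have := weights.isProbabilityMeasure_sum ha fun n => (Z n).μ.map (F n)
  let W : MMSpace.{u} :=
    { carrier := X × Y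
      μ := Measure.sum fun n => ENNReal.ofReal (a n) • (Z n).μ.map (F n) }
  refine ⟨MMClass.mk W, ⟨W, rfl, Z, F, hZ, hF, rfl⟩, ?_, ?_⟩
  · refine ⟨Prod.fst, LipschitzWith.prod_fst.lipschitzOnWith, ?_⟩
    change Measure.map Prod.fst (Measure.sum _) = _
    rw [Measure.map_sum measurable_fst.aemeasurable, hXμ]
    congr 1
    funext n
    rw [Measure.map_smul, AEMeasurable.map_map_of_aemeasurable measurable_fst.aemeasurable (hFm n),
      ← hpμ n, AEMeasurable.map_map_of_aemeasurable _ (MMSpace.aemeasurable_of_lipschitzOn (hp n))]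
    · rfl
    · rw [hpμ n]
      exact MMSpace.aemeasurable_of_lipschitzOn (hf n)
  · refine ⟨Prod.snd, LipschitzWith.prod_snd.lipschitzOnWith, ?_⟩
    change Measure.map Prod.snd (Measure.sum _) = _
    rw [Measure.map_sum measurable_snd.aemeasurable, hYμ]
    congr 1
    funext n
    rw [Measure.map_smul, AEMeasurable.map_map_of_aemeasurable measurable_snd.aemeasurable (hFm n),
      ← hqμ n, AEMeasurable.map_map_of_aemeasurable _ (MMSpace.aemeasurable_of_lipschitzOn (hq n))]
    · rfl
    · rw [hqμ n]
      exact MMSpace.aemeasurable_of_lipschitzOn (hg n)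

/-- If a space is box-close to a member of the direct sum, then its measure decomposes into pieces
that are box-close to members of the summands. -/
theorem exists_decomposition (ha : a ∈ weights N) (hP : ∀ n, IsPyramid (P n)) {X : MMSpace.{u}}
    {y : MMClass.{u}} (hy : y ∈ directSum a P) {ε : ℝ≥0∞} (h : MMClass.box (MMClass.mk X) y < ε) :
    ∃ ν : Idx N → ProbabilityMeasure X,
      X.μ = (Measure.sum fun n => ENNReal.ofReal (a n) • (ν n : Measure X)) ∧
      ∀ n, ∃ z ∈ P n,
        MMClass.box (MMClass.mk (X.withMeasure (ν n))) z ≤ (ENNReal.ofReal (a n))⁻¹ * ε := by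
  obtain ⟨Y, rfl, Z, f, hZ, hf, hμ⟩ := hy
  obtain ⟨π, S, hπ, hS, hdS, hmS⟩ := MMSpace.exists_of_box_lt (X := X) (Y := Y) h
  have := hπ.isProbabilityMeasure
  have hZp := fun n => MMSpace.isProbabilityMeasure_map (hf n)
  have : Nonempty X := X.supp_nonempty.to_type
  obtain ⟨ρ, hρ, hπρ⟩ := Measure.exists_sum_coupling (hπ.2.trans hμ)
  have hρp : ∀ n, IsProbabilityMeasure (ρ n) := fun n =>
    ⟨by rw [← Measure.snd_univ, hρ n]; exact measure_univ⟩
  refine ⟨fun n => ⟨(ρ n).fst, inferInstance⟩, ?_, fun n => ?_⟩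
  · rw [← hπ.1]
    conv_lhs => rw [hπρ]
    rw [Measure.fst_sum]
    simp only [Measure.fst, Measure.map_smul]
    rfl
  -- The `n`-th piece of `Y`: a 1-Lipschitz image of `Z n`, hence in `P n` by downward closure.
  · let W : MMSpace.{u} := Y.withMeasure ⟨(Z n).μ.map (f n), hZp n⟩
    refine ⟨MMClass.mk W, (hP n).downward _ _ (hZ n) ⟨f n, hf n, rfl⟩, ?_⟩
    refine (MMSpace.box_le (X := X.withMeasure ⟨(ρ n).fst, inferInstance⟩) (Y := W) (π := ρ n)
      ⟨rfl, hρ n⟩ hS).trans (max_le ?_ ?_)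
    · refine hdS.le.trans (le_mul_of_one_le_left' ?_)
      exact ENNReal.one_le_inv.2 (weights.ofReal_le_one ha n)
    -- From `ρ n ≤ (a n)⁻¹ • π`, the mass missed by `S` grows by at most the factor `(a n)⁻¹`.
    · have hle := Measure.le_smul_of_eq_sum hπρ (weights.ofReal_ne_zero ha n)
        ENNReal.ofReal_ne_top Sᶜ
      rw [Measure.smul_apply, smul_eq_mul, prob_compl_eq_one_sub hS, prob_compl_eq_one_sub hS]
        at hle
      exact hle.trans (mul_le_mul_right hmS.le _)

theorem mem_of_forall_box_lt (ha : a ∈ weights N) (hP : ∀ n, IsPyramid (P n)) {x : MMClass.{u}}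
    (h : ∀ ε : ℝ≥0∞, 0 < ε → ∃ y ∈ directSum a P, MMClass.box x y < ε) : x ∈ directSum a P := by
  obtain ⟨X, rfl⟩ := Quotient.exists_rep x
  have hstep : ∀ k : ℕ, ∃ ν : Idx N → ProbabilityMeasure X,
      X.μ = (Measure.sum fun n => ENNReal.ofReal (a n) • (ν n : Measure X)) ∧
      ∀ n, ∃ z ∈ P n, MMClass.box (MMClass.mk (X.withMeasure (ν n))) z ≤
        (ENNReal.ofReal (a n))⁻¹ * (k : ℝ≥0∞)⁻¹ := fun k => by
    obtain ⟨y, hy, hb⟩ := h (k : ℝ≥0∞)⁻¹ (ENNReal.inv_pos.2 (ENNReal.natCast_ne_top k))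
    exact exists_decomposition ha hP hy hb
  choose ν hν hclose using hstep
  -- One nonprincipal ultrafilter serves all `n` at once, so no diagonal subsequence is needed.
  let F : Ultrafilter ℕ := hyperfilter ℕ
  have hF : (F : Filter ℕ) ≤ atTop := by
    rw [← Nat.cofinite_eq_atTop]
    exact hyperfilter_le_cofinite
  have hinv : ∀ n, (ENNReal.ofReal (a n))⁻¹ ≠ ∞ := fun n =>
    ENNReal.inv_ne_top.2 (weights.ofReal_ne_zero ha n)
  have hlim := fun n => Measure.exists_setwise_limit (hinv n) F (fun k => (ν k n : Measure X))
    fun k => Measure.le_smul_of_eq_sum (hν k) (weights.ofReal_ne_zero ha n) ENNReal.ofReal_ne_top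
  choose m hm using hlim
  have hmp : ∀ n, IsProbabilityMeasure (m n) := fun n =>
    ⟨tendsto_nhds_unique (hm n univ .univ) (by simp)⟩
  have hsum : X.μ = Measure.sum fun n => ENNReal.ofReal (a n) • m n := by
    have hfin : ∀ n (ρ : Measure X) [IsProbabilityMeasure ρ] s, ENNReal.ofReal (a n) * ρ s ≠ ∞ :=
      fun n ρ _ s => ENNReal.mul_ne_top ENNReal.ofReal_ne_top (measure_ne_top _ _)
    have hap : ∀ (ρ : Idx N → Measure X) s, MeasurableSet s →
        (Measure.sum fun n => ENNReal.ofReal (a n) • ρ n) s =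
          ∑' n, ENNReal.ofReal (a n) * ρ n s := fun ρ s hs => by
      rw [Measure.sum_apply _ hs]
      rfl
    ext s hs
    -- For infinitely many summands the limit passes through the sum because the `n`-th term is at
    -- most `a n`.
    have key := tendsto_tsum_of_dominated_convergence (𝓕 := (F : Filter ℕ))
      (f := fun k n => (ENNReal.ofReal (a n) * (ν k n : Measure X) s).toReal)
      (g := fun n => (ENNReal.ofReal (a n) * m n s).toReal)
      (bound := a) ha.2.summable
      (fun n => (ENNReal.tendsto_toReal_iff (fun k => hfin n _ s) (hfin n _ s)).2
        (ENNReal.Tendsto.const_mul (hm n s hs) (Or.inr ENNReal.ofReal_ne_top)))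
      (Eventually.of_forall fun k n => by
        rw [Real.norm_of_nonneg ENNReal.toReal_nonneg]
        refine ENNReal.toReal_le_of_le_ofReal (ha.1 n).1.le (mul_le_of_le_one_right' prob_le_one))
    rw [← ENNReal.tsum_toReal_eq fun n => hfin n _ s, ← hap _ s hs] at key
    simp only [← ENNReal.tsum_toReal_eq fun n => hfin n (ν _ n : Measure X) s, ← hap _ s hs,
      ← hν] at key
    have := weights.isProbabilityMeasure_sum ha m
    exact (ENNReal.toReal_eq_toReal_iff' (measure_ne_top _ _) (measure_ne_top _ _)).1
      (tendsto_nhds_unique tendsto_const_nhds key)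
  refine ⟨X, rfl, fun n => X.withMeasure ⟨m n, hmp n⟩, fun _ => id, fun n => ?_,
    fun _ => LipschitzWith.id.lipschitzOnWith, ?_⟩
  · by_contra hn
    -- A ball avoiding `P n` is contradicted by the chain from the limit to `ν k n` to a point of `P
    -- n`, each step below `ε / 2`.
    obtain ⟨ε, hε, hball⟩ := (hP n).isClosed.isOpen_compl _ hn
    have hε2 : 0 < ε / 2 := ENNReal.half_pos hε.ne'
    have e₁ := MMSpace.eventually_box_withMeasure_lt X (l := (F : Filter ℕ))
      (ν := ⟨m n, hmp n⟩) (ν' := fun k => ν k n) (hm n) hε2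
    have e₂ : ∀ᶠ k in (F : Filter ℕ),
        (ENNReal.ofReal (a n))⁻¹ * ((k : ℕ) : ℝ≥0∞)⁻¹ < ε / 2 := by
      have := ENNReal.Tendsto.const_mul ENNReal.tendsto_inv_nat_nhds_zero (Or.inr (hinv n))
      rw [mul_zero] at this
      exact (this.mono_left hF).eventually (gt_mem_nhds hε2)
    obtain ⟨k, hk₁, hk₂⟩ := (e₁.and e₂).exists
    obtain ⟨z, hz, hzk⟩ := hclose k n
    obtain ⟨Z, rfl⟩ := Quotient.exists_rep z
    refine hball _ ?_ hz
    refine (MMSpace.box_triangle _ (X.withMeasure (ν k n)) Z).trans_lt ?_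
    rw [← ENNReal.add_halves ε]
    exact ENNReal.add_lt_add hk₁ (lt_of_le_of_lt hzk hk₂)
  · change X.μ = Measure.sum fun n => ENNReal.ofReal (a n) • (m n).map id
    simpa only [Measure.map_id] using hsum

theorem isClosed (ha : a ∈ weights N) (hP : ∀ n, IsPyramid (P n)) : IsClosed (directSum a P) := by
  refine isOpen_compl_iff.1 fun x hx => ?_
  by_contra! hcon
  refine hx (mem_of_forall_box_lt ha hP fun ε hε => ?_)
  obtain ⟨y, hy, hyD⟩ := hcon ε hε
  exact ⟨y, not_not.1 hyD, hy⟩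

end directSum

theorem theorem1p1 {N : ℕ∞} (a : Idx N → ℝ) (ha : a ∈ weights N)
    (P : Idx N → Set MMClass.{u}) (hP : ∀ n, IsPyramid (P n)) :
    IsPyramid (directSum a P) where
  nonempty := directSum.nonempty ha fun n => (hP n).nonempty
  isClosed := directSum.isClosed ha hP
  downward _ _ hy hxy := directSum.downward ha hy hxy
  directed _ hx _ hy := directSum.directed ha hP hx hy
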